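/- Let $d\ge 0$, let $\|\cdot\|$ be the Euclidean norm on $\mathbb R^d$, and let $\mathcal P^p(\mathbb R^d)$ be the set of Borel probability measures $\mu$ on $\mathbb R^d$ with $\int\|x\|^p\,d\mu<\infty$. Let $A_1,A_2,A_3>0$ and let $\Phi$ be a class of functions $f:\mathbb R^d\to\mathbb R$ such that: 1. if $s$ is a finite signed Borel measure on $\mathbb R^d$ such that every $f\in\Phi$ is integrable with respect to $|s|$ and $\int f\,ds=0$ for all $f\in\Phi$, then $s=0$; 2. for every $f\in\Phi$, $|f(x)-f(y)|\le A_1\|x-y\|$ for all $x,y\in\mathbb R^d$, and $|f(0)|\le A_2$; 3. for all $n\ge1$ and $x^1,\dots,x^n\in\mathbb R^d$, $$\frac1n\,\mathbb E\sup_{f\in\Phi}\Bigl|\sum_{i=1}^n\xi_i f(x^i)\Bigr|\le\frac{A_3}{n}\sqrt{\sum_{i=1}^n(\|x^i\|^2+1)},$$ where $\xi_1,\dots,\xi_n$ are i.i.d. with $\mathbb P(\xi_i=1)=\mathbb P(\xi_i=-1)=\frac12$. Put $D_\Phi(\mu,\mu')=\sup_{f\in\Phi}\bigl|\int f\,d(\mu-\mu')\bigr|$,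 and let $W_p(\mu,\mu')=\bigl(\inf_\gamma\int\|x-y\|^p\,d\gamma(x,y)\bigr)^{1/p}\in[0,\infty]$, where $\gamma$ ranges over the couplings of $\mu$ and $\mu'$. Then: **(a)** $D_\Phi$ is a (finite) metric on $\mathcal P^1(\mathbb R^d)$. Moreover $D_\Phi(\mu,\mu')\le A_1W_1(\mu,\mu')$ for $\mu,\mu'\in\mathcal P^1(\mathbb R^d)$, and $A_1W_1(\mu,\mu')\le A_1W_2(\mu,\mu')$ for $\mu,\mu'\in\mathcal P^2(\mathbb R^d)$. **(b)** Let $\mu\in\mathcal P^2(\mathbb R^d)$, let $n\ge1$, let $X^1,\dots,X^n$ be i.i.d. random variables with law $\mu$, and let $\bar\mu^n=\frac1n\sum_{i=1}^n\delta_{X^i}$. Then $D_\Phi(\mu,\bar\mu^n)$ and its square are integrable and $$\mathbb E\,D_\Phi(\mu,\bar\mu^n)\le\frac{2A_3}{\sqrt n}\sqrt{\int(\|x\|^2+1)\,d\mu(x)},$$ $$\mathbb E\bigl[D_\Phi^2(\mu,\bar\mu^n)\bigr]\le\frac{A_1^2}{n}\int\|x\|^2\,d\mu(x)+\frac{4A_3^2}{n}\int(\|x\|^2+1)\,d\mu(x).$$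 **(c)** Let $\kappa>0$ and let $\mu$ be a Borel probability measure on $\mathbb R^d$ satisfying the $T_1$ inequality $W_1^2(\mu,\tilde\mu)\le2\kappa^2\,\mathcal H(\tilde\mu|\mu)$ for all probability measures $\tilde\mu\ll\mu$, where $\mathcal H(\tilde\mu|\mu)=\int\frac{d\tilde\mu}{d\mu}\log\frac{d\tilde\mu}{d\mu}\,d\mu\in[0,\infty]$ is the relative entropy. Then $\mu\in\mathcal P^2(\mathbb R^d)$, and for every $n\ge1$, all i.i.d. $X^1,\dots,X^n$ with law $\mu$ and empirical measure $\bar\mu^n$, and every $a\ge0$, $$\mathbb P\Bigl(D_\Phi(\mu,\bar\mu^n)-\frac{2A_3}{\sqrt n}\sqrt{\int(\|x\|^2+1)\,d\mu(x)}\ge a\Bigr)\le\exp\Bigl(-\frac{na^2}{2A_1^2\kappa^2}\Bigr).$$ -/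

import Mathlib

open MeasureTheory ProbabilityTheory
open scoped ENNReal

namespace GMMD

/-- `ℝ^d` with the Euclidean norm. -/
abbrev E (d : ℕ) : Type := EuclideanSpace ℝ (Fin d)

/-- `𝒫^p(ℝ^d)`: the Borel probability measures on `ℝ^d` with finite `p`-th moment. -/
def finiteMoment (d : ℕ) (p : ℝ) : Set (Measure (E d)) :=
  {μ | IsProbabilityMeasure μ ∧ ∫⁻ x, ‖x‖ₑ ^ p ∂μ < ∞}

/-- The generalized maximum mean discrepancy
`D_Φ(μ, ν) = sup_{f ∈ Φ} |∫ f d(μ - ν)|`. -/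
noncomputable def gmmd {d : ℕ} (Φ : Set (E d → ℝ)) (μ ν : Measure (E d)) : ℝ :=
  ⨆ f : Φ, |(∫ x, f.1 x ∂μ) - ∫ x, f.1 x ∂ν|

/-- The empirical Rademacher complexity of `Φ` at the points `x 0, …, x (n - 1)`. The signs are
independent and uniform on `{1, -1}`, so the expectation is the average over all `2 ^ n` sign
vectors. -/
noncomputable def rademacher {d : ℕ} (Φ : Set (E d → ℝ)) {n : ℕ} (x : Fin n → E d) : ℝ :=
  (1 / (n : ℝ)) * ((1 / 2 : ℝ) ^ n *
    ∑ ξ : Fin n → ℤˣ, ⨆ f : Φ, |∑ i, (((ξ i : ℤˣ) : ℤ) : ℝ) * f.1 (x i)|)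

/-- The standing assumption on a class `Φ` of test functions, with constants `A₁, A₂, A₃`. -/
structure IsTestClass {d : ℕ} (Φ : Set (E d → ℝ)) (A₁ A₂ A₃ : ℝ) : Prop where
  pos₁ : 0 < A₁
  pos₂ : 0 < A₂
  pos₃ : 0 < A₃
  /-- A finite signed measure which integrates every `f ∈ Φ` (absolutely) to zero vanishes. -/
  separating : ∀ s : SignedMeasure (E d),
    (∀ f ∈ Φ, s.Integrable f ∧ ∫ᵛ x, f x ∂<•s = 0) → s = 0
  lipschitz : ∀ f ∈ Φ, ∀ x y, |f x - f y| ≤ A₁ * ‖x - y‖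
  bound_zero : ∀ f ∈ Φ, |f 0| ≤ A₂
  rademacher_le : ∀ n : ℕ, 1 ≤ n → ∀ x : Fin n → E d,
    rademacher Φ x ≤ A₃ / n * √(∑ i, (‖x i‖ ^ 2 + 1))

/-- `D` is a metric on the set `S`. -/
structure IsMetricOn {α : Type*} (S : Set α) (D : α → α → ℝ) : Prop where
  nonneg : ∀ μ ∈ S, ∀ ν ∈ S, 0 ≤ D μ ν
  eq_zero_iff : ∀ μ ∈ S, ∀ ν ∈ S, (D μ ν = 0 ↔ μ = ν)
  symm : ∀ μ ∈ S, ∀ ν ∈ S, D μ ν = D ν μ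
  triangle : ∀ μ ∈ S, ∀ ν ∈ S, ∀ ρ ∈ S, D μ ρ ≤ D μ ν + D ν ρ

/-- The couplings of `μ` and `ν`. -/
def couplings {d : ℕ} (μ ν : Measure (E d)) : Set (Measure (E d × E d)) :=
  {γ | IsProbabilityMeasure γ ∧ γ.map Prod.fst = μ ∧ γ.map Prod.snd = ν}

/-- The `p`-Wasserstein distance, with values in `[0, ∞]`. -/
noncomputable def wasserstein {d : ℕ} (p : ℝ) (μ ν : Measure (E d)) : ℝ≥0∞ :=
  (⨅ γ ∈ couplings μ ν, ∫⁻ z, ‖z.1 - z.2‖ₑ ^ p ∂γ) ^ (1 / p)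

/-- The `T₁` transport inequality with constant `κ`. Here `klDiv ν μ` is the relative entropy
`H(ν | μ) = ∫ (dν/dμ) log (dν/dμ) dμ`, with values in `[0, ∞]`. -/
def SatisfiesT1 {d : ℕ} (κ : ℝ) (μ : Measure (E d)) : Prop :=
  ∀ ν : Measure (E d), IsProbabilityMeasure ν → ν ≪ μ →
    wasserstein 1 μ ν ^ 2 ≤ ENNReal.ofReal (2 * κ ^ 2) * InformationTheory.klDiv ν μ

/-- The empirical measure `(1/n) ∑ δ_{x i}`. -/
noncomputable def empirical {d n : ℕ} (x : Fin n → E d) : Measure (E d) :=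
  (n : ℝ≥0∞)⁻¹ • ∑ i, Measure.dirac (x i)

end GMMD

namespace GMMD

/-! ### Lipschitz functions of independent variables: integrability, variance, exponential moments
-/

section Lipschitz

/-! Part (a) is soft: a coupling bounds `|∫ f dμ - ∫ f dν|` by the transport cost, and the
separating hypothesis applied to `μ - ν` gives definiteness.

For (b) and (c), moving one sample point by `δ` changes each empirical mean by at most `A₁ δ / n`,
so the discrepancy is `A₁ / n`-Lipschitz in the sample for the `ℓ¹` distance
(`IsTestClass.abs_gmmd_empirical_sub_le`). This makes a supremum over a possibly uncountable `Φ`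
continuous, hence measurable, with linear growth.

The mean is bounded by symmetrization. An independent ghost sample replaces `μ`
(`IsTestClass.gmmd_empirical_le`), exchanging a point with its ghost inserts signs
(`IsTestClass.integral_supIncr_eq`), and Jensen's inequality turns the Rademacher hypothesis into
the rate `1 / √n`.

Fluctuations tensorize by integrating out all coordinates but the first, which preserves the
Lipschitz constant. Each coordinate adds `L² ∫ ‖x‖²` to the variance (`integral_sq_pi_le`). Under
`T₁` it adds `κ² L² / 2` to the log-Laplace transform (`SatisfiesT1.lintegral_exp_le`,
`lintegral_exp_pi_le`): the inequality is tested on the tilted measure `e^f μ / ∫ e^f dμ`.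
Chernoff's bound concludes. Exponential moments are estimated in `[0, ∞]`, so their finiteness is a
conclusion. -/

lemma abs_iSup_sub_iSup_le {ι : Type*} {u v : ι → ℝ} (hu : BddAbove (Set.range u))
    (hv : BddAbove (Set.range v)) {C : ℝ} (hC : 0 ≤ C) (h : ∀ i, |u i - v i| ≤ C) :
    |(⨆ i, u i) - ⨆ i, v i| ≤ C := by
  -- Over an empty index both real suprema are 0 by convention; only here is `hC` needed.
  rcases isEmpty_or_nonempty ι with hι | hι
  · simpa [Real.iSup_of_isEmpty] using hC
  rw [abs_le]
  constructor
  · have : (⨆ i, v i) ≤ (⨆ i, u i) + C := ciSup_le fun i => by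
      have := (abs_le.1 (h i)).1
      linarith [le_ciSup hu i]
    linarith
  · have : (⨆ i, u i) ≤ (⨆ i, v i) + C := ciSup_le fun i => by
      have := (abs_le.1 (h i)).2
      linarith [le_ciSup hv i]
    linarith

/-- A general modulus `D` covers both the norm and the `ℓ¹` sum on a product, whose own metric is
the maximum. -/
lemma continuous_of_abs_sub_le {Z : Type*} [TopologicalSpace Z] {F : Z → ℝ} {D : Z → Z → ℝ}
    (hD : ∀ x, Continuous fun y => D y x) (h0 : ∀ x, D x x = 0)
    (h : ∀ y x, |F y - F x| ≤ D y x) : Continuous F := by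
  rw [continuous_iff_continuousAt]
  intro x
  rw [ContinuousAt, tendsto_iff_norm_sub_tendsto_zero]
  refine squeeze_zero (fun _ => norm_nonneg _) (fun y => h y x) ?_
  simpa [h0] using (hD x).tendsto x

lemma integral_pi_fin_succ {X : Type*} [MeasurableSpace X] {μ : Measure X}
    [IsProbabilityMeasure μ] {n : ℕ} {F : (Fin (n + 1) → X) → ℝ}
    (hF : Integrable F (Measure.pi fun _ => μ)) :
    ∫ z, F z ∂(Measure.pi fun _ => μ)
      = ∫ x, ∫ y, F (Fin.cons x y) ∂(Measure.pi fun _ : Fin n => μ) ∂μ := by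
  have hm := (measurePreserving_piFinSuccAbove (fun _ : Fin (n + 1) => μ) 0).symm
  rw [← hm.integral_comp', integral_prod]
  · simp [MeasurableEquiv.piFinSuccAbove, Fin.consEquiv]
  · exact hm.integrable_comp_of_integrable hF

lemma lintegral_pi_fin_succ {X : Type*} [MeasurableSpace X] {μ : Measure X}
    [IsProbabilityMeasure μ] {n : ℕ} {F : (Fin (n + 1) → X) → ℝ≥0∞} (hF : Measurable F) :
    ∫⁻ z, F z ∂(Measure.pi fun _ => μ)
      = ∫⁻ x, ∫⁻ y, F (Fin.cons x y) ∂(Measure.pi fun _ : Fin n => μ) ∂μ := by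
  have hm := (measurePreserving_piFinSuccAbove (fun _ : Fin (n + 1) => μ) 0).symm
  rw [← hm.lintegral_comp hF, lintegral_prod]
  · simp [MeasurableEquiv.piFinSuccAbove, Fin.consEquiv]
  · exact (hF.comp hm.measurable).aemeasurable

variable {E : Type*} [NormedAddCommGroup E]

lemma continuous_of_abs_sub_le_norm {f : E → ℝ} {L : ℝ}
    (hf : ∀ x y, |f x - f y| ≤ L * ‖x - y‖) : Continuous f :=
  continuous_of_abs_sub_le (fun _ => by fun_prop) (fun _ => by simp) hf

lemma continuous_of_abs_sub_le_sum {ι : Type*} [Fintype ι] {F : (ι → E) → ℝ} {L : ℝ}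
    (hF : ∀ x y, |F x - F y| ≤ L * ∑ i, ‖x i - y i‖) : Continuous F :=
  continuous_of_abs_sub_le (fun _ => by fun_prop) (fun _ => by simp) hF

lemma abs_sub_le_sum_cons {n : ℕ} {F : (Fin (n + 1) → E) → ℝ} {L : ℝ}
    (hF : ∀ x y, |F x - F y| ≤ L * ∑ i, ‖x i - y i‖) (x : E) (y y' : Fin n → E) :
    |F (Fin.cons x y) - F (Fin.cons x y')| ≤ L * ∑ i, ‖y i - y' i‖ := by
  simpa [Fin.sum_univ_succ] using hF (Fin.cons x y) (Fin.cons x y')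

variable [MeasurableSpace E] [BorelSpace E] {μ : Measure E} [IsProbabilityMeasure μ]

lemma memLp_of_abs_sub_le_norm {p : ℝ≥0∞} {f : E → ℝ} {L : ℝ}
    (hf : ∀ x y, |f x - f y| ≤ L * ‖x - y‖) (hμ : MemLp (fun x => ‖x‖) p μ) : MemLp f p μ := by
  refine ((memLp_const |f 0|).add (hμ.const_mul L)).mono'
    (continuous_of_abs_sub_le_norm hf).aestronglyMeasurable (.of_forall fun x => ?_)
  have h1 := hf x 0
  have h2 := abs_sub_abs_le_abs_sub (f x) (f 0)
  simp only [sub_zero] at h1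
  simp only [Pi.add_apply, Real.norm_eq_abs]
  linarith

/-- The variance is at most the second moment about any constant. About `f 0`, the Lipschitz bound
gives `L² ‖x‖²`. -/
lemma integral_sq_le_of_abs_sub_le_norm {f : E → ℝ} {L : ℝ}
    (hf : ∀ x y, |f x - f y| ≤ L * ‖x - y‖) (hμ : MemLp (fun x => ‖x‖) 2 μ) :
    ∫ x, f x ^ 2 ∂μ ≤ (∫ x, f x ∂μ) ^ 2 + L ^ 2 * ∫ x, ‖x‖ ^ 2 ∂μ := by
  have h2 : MemLp f 2 μ := memLp_of_abs_sub_le_norm hf hμ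
  have h1 : Integrable f μ := h2.integrable (by norm_num)
  have hle : ∫ x, (f x - f 0) ^ 2 ∂μ ≤ ∫ x, L ^ 2 * ‖x‖ ^ 2 ∂μ := by
    refine integral_mono (h2.sub (memLp_const (f 0))).integrable_sq
      (hμ.integrable_sq.const_mul _) fun x => ?_
    have := hf x 0
    rw [sub_zero] at this
    simpa [mul_pow] using pow_le_pow_left₀ (abs_nonneg _) this 2
  have heq : ∫ x, (f x - f 0) ^ 2 ∂μ
      = ∫ x, f x ^ 2 ∂μ - 2 * f 0 * ∫ x, f x ∂μ + f 0 ^ 2 := by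
    have : ∀ x, (f x - f 0) ^ 2 = f x ^ 2 - 2 * f 0 * f x + f 0 ^ 2 := fun x => by ring
    simp_rw [this]
    rw [integral_add, integral_sub, integral_const_mul]
    · simp
    · exact h2.integrable_sq
    · exact h1.const_mul _
    · exact h2.integrable_sq.sub (h1.const_mul _)
    · exact integrable_const _
  rw [integral_const_mul, heq] at hle
  nlinarith [sq_nonneg (∫ x, f x ∂μ - f 0)]

variable [SecondCountableTopology E]

lemma memLp_pi_of_abs_sub_le_sum {ι : Type*} [Fintype ι] {p : ℝ≥0∞} {F : (ι → E) → ℝ} {L : ℝ}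
    (hF : ∀ x y, |F x - F y| ≤ L * ∑ i, ‖x i - y i‖) (hμ : MemLp (fun x => ‖x‖) p μ) :
    MemLp F p (Measure.pi fun _ : ι => μ) := by
  have hs : MemLp (fun x : ι → E => ∑ i, ‖x i‖) p (Measure.pi fun _ : ι => μ) :=
    memLp_finsetSum _ fun i _ =>
      hμ.comp_measurePreserving (measurePreserving_eval (fun _ : ι => μ) i)
  refine ((memLp_const |F 0|).add (hs.const_mul L)).mono'
    (continuous_of_abs_sub_le_sum hF).aestronglyMeasurable (.of_forall fun x => ?_)
  have h1 := hF x 0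
  have h2 := abs_sub_abs_le_abs_sub (F x) (F 0)
  simp only [Pi.zero_apply, sub_zero] at h1
  simp only [Pi.add_apply, Real.norm_eq_abs]
  linarith

/-- This is what lets the one-variable bounds be applied to the conditional mean in the inductions
below. -/
lemma abs_integral_cons_sub_le {n : ℕ} {F : (Fin (n + 1) → E) → ℝ} {L : ℝ}
    (hF : ∀ x y, |F x - F y| ≤ L * ∑ i, ‖x i - y i‖) (hμ : Integrable (fun x => ‖x‖) μ)
    (x x' : E) :
    |(∫ y, F (Fin.cons x y) ∂(Measure.pi fun _ : Fin n => μ))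
      - ∫ y, F (Fin.cons x' y) ∂(Measure.pi fun _ : Fin n => μ)| ≤ L * ‖x - x'‖ := by
  have hi (x : E) : Integrable (fun y => F (Fin.cons x y)) (Measure.pi fun _ : Fin n => μ) :=
    memLp_one_iff_integrable.1
      (memLp_pi_of_abs_sub_le_sum (abs_sub_le_sum_cons hF x) (memLp_one_iff_integrable.2 hμ))
  rw [← integral_sub (hi x) (hi x')]
  have := norm_integral_le_of_norm_le_const (μ := Measure.pi fun _ : Fin n => μ)
    (f := fun y => F (Fin.cons x y) - F (Fin.cons x' y)) (C := L * ‖x - x'‖)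
    (.of_forall fun y => by
      simpa [Fin.sum_univ_succ] using hF (Fin.cons x y) (Fin.cons x' y))
  simpa using this

/-- A variance bound for Lipschitz functions of independent variables. -/
lemma integral_sq_pi_le {L : ℝ} (hμ : MemLp (fun x => ‖x‖) 2 μ) {n : ℕ} :
    ∀ {F : (Fin n → E) → ℝ}, (∀ x y, |F x - F y| ≤ L * ∑ i, ‖x i - y i‖) →
      ∫ x, F x ^ 2 ∂(Measure.pi fun _ => μ)
        ≤ (∫ x, F x ∂(Measure.pi fun _ => μ)) ^ 2 + n * (L ^ 2 * ∫ x, ‖x‖ ^ 2 ∂μ) := by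
  induction n with
  | zero =>
    intro F hF
    have hF0 : F = fun _ => F 0 := funext fun x => congrArg F (Subsingleton.elim _ _)
    rw [hF0]
    simp
  | succ n ih =>
    intro F hF
    have hμ1 : Integrable (fun x => ‖x‖) μ := hμ.integrable (by norm_num)
    have h2 := memLp_pi_of_abs_sub_le_sum hF hμ
    rw [integral_pi_fin_succ h2.integrable_sq, integral_pi_fin_succ (h2.integrable (by norm_num))]
    -- The conditional mean given the first coordinate: induction bounds the conditional second
    -- moment by `G²` plus `n` terms, and the one-variable bound for `G` supplies the last term.
    set G : E → ℝ := fun x => ∫ y, F (Fin.cons x y) ∂(Measure.pi fun _ : Fin n => μ) with hG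
    have hGl : ∀ x y, |G x - G y| ≤ L * ‖x - y‖ := abs_integral_cons_sub_le hF hμ1
    have hG2 : MemLp G 2 μ := memLp_of_abs_sub_le_norm hGl hμ
    have hint : Integrable (fun x => ∫ y, F (Fin.cons x y) ^ 2 ∂(Measure.pi fun _ : Fin n => μ))
        μ := by
      have hm := (measurePreserving_piFinSuccAbove (fun _ : Fin (n + 1) => μ) 0).symm
      have := (hm.integrable_comp_of_integrable h2.integrable_sq).integral_prod_left
      simpa [MeasurableEquiv.piFinSuccAbove, Fin.consEquiv] using this
    calc ∫ x, ∫ y, F (Fin.cons x y) ^ 2 ∂(Measure.pi fun _ : Fin n => μ) ∂μ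
        ≤ ∫ x, (G x ^ 2 + n * (L ^ 2 * ∫ x, ‖x‖ ^ 2 ∂μ)) ∂μ :=
          integral_mono hint (hG2.integrable_sq.add (integrable_const _)) fun x =>
            ih (abs_sub_le_sum_cons hF x)
      _ = ∫ x, G x ^ 2 ∂μ + n * (L ^ 2 * ∫ x, ‖x‖ ^ 2 ∂μ) := by
          rw [integral_add hG2.integrable_sq (integrable_const _)]
          simp
      _ ≤ _ := by
          have := integral_sq_le_of_abs_sub_le_norm hGl hμ
          push_cast
          linarith

/-- Tensorization of a bound on the exponential moments of Lipschitz functions. -/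
lemma lintegral_exp_pi_le {L c : ℝ} (hμ : Integrable (fun x => ‖x‖) μ)
    (hexp : ∀ f : E → ℝ, (∀ x y, |f x - f y| ≤ L * ‖x - y‖) →
      ∫⁻ x, ENNReal.ofReal (Real.exp (f x)) ∂μ ≤ ENNReal.ofReal (Real.exp (∫ x, f x ∂μ + c)))
    {n : ℕ} :
    ∀ {F : (Fin n → E) → ℝ}, (∀ x y, |F x - F y| ≤ L * ∑ i, ‖x i - y i‖) →
      ∫⁻ x, ENNReal.ofReal (Real.exp (F x)) ∂(Measure.pi fun _ => μ)
        ≤ ENNReal.ofReal (Real.exp (∫ x, F x ∂(Measure.pi fun _ => μ) + n * c)) := by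
  induction n with
  | zero =>
    intro F hF
    have hF0 : F = fun _ => F 0 := funext fun x => congrArg F (Subsingleton.elim _ _)
    rw [hF0]
    simp
  | succ n ih =>
    intro F hF
    have h1 := memLp_one_iff_integrable.1
      (memLp_pi_of_abs_sub_le_sum hF (memLp_one_iff_integrable.2 hμ))
    have hc := continuous_of_abs_sub_le_sum hF
    rw [lintegral_pi_fin_succ (by fun_prop), integral_pi_fin_succ h1]
    set G : E → ℝ := fun x => ∫ y, F (Fin.cons x y) ∂(Measure.pi fun _ : Fin n => μ) with hG
    have hGl : ∀ x y, |G x - G y| ≤ L * ‖x - y‖ := abs_integral_cons_sub_le hF hμ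
    have hGi : Integrable G μ := memLp_one_iff_integrable.1
      (memLp_of_abs_sub_le_norm hGl (memLp_one_iff_integrable.2 hμ))
    calc _ ≤ ∫⁻ x, ENNReal.ofReal (Real.exp (G x + n * c)) ∂μ :=
          lintegral_mono fun x => ih (abs_sub_le_sum_cons hF x)
      -- Adding the constant `n * c` leaves the Lipschitz constant unchanged, so `hexp` applies.
      _ ≤ ENNReal.ofReal (Real.exp (∫ x, (G x + n * c) ∂μ + c)) :=
          hexp _ fun x y => by simpa using hGl x y
      _ = _ := by
          rw [integral_add hGi (integrable_const _)]
          simp only [integral_const, probReal_univ, smul_eq_mul, one_mul, Nat.cast_succ]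
          ring_nf

end Lipschitz

/-! ### Suprema over the test class, symmetrization and the mean bound -/

section TestClass

variable {d : ℕ} {Φ : Set (E d → ℝ)} {A₁ A₂ A₃ : ℝ}

lemma IsTestClass.abs_le (hΦ : IsTestClass Φ A₁ A₂ A₃) {f : E d → ℝ} (hf : f ∈ Φ) (x : E d) :
    |f x| ≤ A₂ + A₁ * ‖x‖ := by
  have h1 := hΦ.lipschitz f hf x 0
  have h2 := hΦ.bound_zero f hf
  have h3 := abs_sub_abs_le_abs_sub (f x) (f 0)
  rw [sub_zero] at h1
  linarith

lemma IsTestClass.integrable (hΦ : IsTestClass Φ A₁ A₂ A₃) {f : E d → ℝ} (hf : f ∈ Φ)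
    {μ : Measure (E d)} [IsProbabilityMeasure μ] (hμ : Integrable (fun x => ‖x‖) μ) :
    Integrable f μ :=
  memLp_one_iff_integrable.1
    (memLp_of_abs_sub_le_norm (hΦ.lipschitz f hf) (memLp_one_iff_integrable.2 hμ))

lemma IsTestClass.abs_integral_le (hΦ : IsTestClass Φ A₁ A₂ A₃) {f : E d → ℝ} (hf : f ∈ Φ)
    {μ : Measure (E d)} [IsProbabilityMeasure μ] (hμ : Integrable (fun x => ‖x‖) μ) :
    |∫ x, f x ∂μ| ≤ A₂ + A₁ * ∫ x, ‖x‖ ∂μ := by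
  calc |∫ x, f x ∂μ| ≤ ∫ x, |f x| ∂μ := abs_integral_le_integral_abs
    _ ≤ ∫ x, (A₂ + A₁ * ‖x‖) ∂μ :=
        integral_mono (hΦ.integrable hf hμ).abs ((integrable_const _).add (hμ.const_mul _))
          (hΦ.abs_le hf)
    _ = _ := by
        rw [integral_add (integrable_const _) (hμ.const_mul _), integral_const_mul]
        simp

/-- The growth bound `A₂ + A₁ ‖x‖` is uniform in `Φ`. An unbounded real supremum would take the
default value 0, so comparisons of a member with the supremum rely on this. -/
lemma IsTestClass.bddAbove_gmmd (hΦ : IsTestClass Φ A₁ A₂ A₃) {μ ν : Measure (E d)}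
    [IsProbabilityMeasure μ] [IsProbabilityMeasure ν] (hμ : Integrable (fun x => ‖x‖) μ)
    (hν : Integrable (fun x => ‖x‖) ν) :
    BddAbove (Set.range fun f : Φ => |(∫ x, f.1 x ∂μ) - ∫ x, f.1 x ∂ν|) := by
  refine ⟨(A₂ + A₁ * ∫ x, ‖x‖ ∂μ) + (A₂ + A₁ * ∫ x, ‖x‖ ∂ν), ?_⟩
  rintro _ ⟨f, rfl⟩
  exact (abs_sub _ _).trans
    (add_le_add (hΦ.abs_integral_le f.2 hμ) (hΦ.abs_integral_le f.2 hν))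

/-- The supremum of weighted sums over the class `Φ`. -/
noncomputable def supSum (Φ : Set (E d → ℝ)) {n : ℕ} (ε : Fin n → ℝ) (x : Fin n → E d) : ℝ :=
  ⨆ f : Φ, |∑ i, ε i * f.1 (x i)|

/-- The supremum of weighted sums of increments over the class `Φ`. -/
noncomputable def supIncr (Φ : Set (E d → ℝ)) {n : ℕ} (ε : Fin n → ℝ) (z : Fin n → E d × E d) :
    ℝ :=
  ⨆ f : Φ, |∑ i, ε i * (f.1 (z i).2 - f.1 (z i).1)|

lemma supIncr_nonneg {n : ℕ} (ε : Fin n → ℝ) (z : Fin n → E d × E d) : 0 ≤ supIncr Φ ε z :=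
  Real.iSup_nonneg fun _ => abs_nonneg _

lemma IsTestClass.bddAbove_supSum (hΦ : IsTestClass Φ A₁ A₂ A₃) {n : ℕ} (ε : Fin n → ℝ)
    (x : Fin n → E d) : BddAbove (Set.range fun f : Φ => |∑ i, ε i * f.1 (x i)|) := by
  refine ⟨∑ i, |ε i| * (A₂ + A₁ * ‖x i‖), ?_⟩
  rintro _ ⟨f, rfl⟩
  refine (Finset.abs_sum_le_sum_abs _ _).trans (Finset.sum_le_sum fun i _ => ?_)
  rw [abs_mul]
  exact mul_le_mul_of_nonneg_left (hΦ.abs_le f.2 _) (abs_nonneg _)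

lemma IsTestClass.bddAbove_supIncr (hΦ : IsTestClass Φ A₁ A₂ A₃) {n : ℕ} (ε : Fin n → ℝ)
    (z : Fin n → E d × E d) :
    BddAbove (Set.range fun f : Φ => |∑ i, ε i * (f.1 (z i).2 - f.1 (z i).1)|) := by
  refine ⟨∑ i, |ε i| * (A₁ * ‖(z i).2 - (z i).1‖), ?_⟩
  rintro _ ⟨f, rfl⟩
  refine (Finset.abs_sum_le_sum_abs _ _).trans (Finset.sum_le_sum fun i _ => ?_)
  rw [abs_mul]
  exact mul_le_mul_of_nonneg_left (hΦ.lipschitz f.1 f.2 _ _) (abs_nonneg _)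

lemma IsTestClass.abs_supSum_sub_le (hΦ : IsTestClass Φ A₁ A₂ A₃) {n : ℕ} {ε : Fin n → ℝ}
    (hε : ∀ i, |ε i| = 1) (x y : Fin n → E d) :
    |supSum Φ ε x - supSum Φ ε y| ≤ A₁ * ∑ i, ‖x i - y i‖ := by
  refine abs_iSup_sub_iSup_le (hΦ.bddAbove_supSum ε x) (hΦ.bddAbove_supSum ε y)
    (mul_nonneg hΦ.pos₁.le (Finset.sum_nonneg fun _ _ => norm_nonneg _)) fun f => ?_
  refine (abs_abs_sub_abs_le_abs_sub _ _).trans ?_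
  rw [← Finset.sum_sub_distrib, Finset.mul_sum]
  refine (Finset.abs_sum_le_sum_abs _ _).trans (Finset.sum_le_sum fun i _ => ?_)
  rw [← mul_sub, abs_mul, hε, one_mul]
  exact hΦ.lipschitz f.1 f.2 _ _

/-- The factor 2 arises because each increment has two endpoints, each moved by at most the maximum
norm of the pair. -/
lemma IsTestClass.abs_supIncr_sub_le (hΦ : IsTestClass Φ A₁ A₂ A₃) {n : ℕ} {ε : Fin n → ℝ}
    (hε : ∀ i, |ε i| = 1) (z w : Fin n → E d × E d) :
    |supIncr Φ ε z - supIncr Φ ε w| ≤ (2 * A₁) * ∑ i, ‖z i - w i‖ := by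
  refine abs_iSup_sub_iSup_le (hΦ.bddAbove_supIncr ε z) (hΦ.bddAbove_supIncr ε w)
    (mul_nonneg (by linarith [hΦ.pos₁]) (Finset.sum_nonneg fun _ _ => norm_nonneg _)) fun f => ?_
  refine (abs_abs_sub_abs_le_abs_sub _ _).trans ?_
  rw [← Finset.sum_sub_distrib, Finset.mul_sum]
  refine (Finset.abs_sum_le_sum_abs _ _).trans (Finset.sum_le_sum fun i _ => ?_)
  have h0 : |ε i * (f.1 (z i).2 - f.1 (z i).1) - ε i * (f.1 (w i).2 - f.1 (w i).1)|
      = |(f.1 (z i).2 - f.1 (w i).2) - (f.1 (z i).1 - f.1 (w i).1)| := by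
    rw [← mul_sub, abs_mul, hε, one_mul]
    ring_nf
  rw [h0]
  have h1 := (hΦ.lipschitz f.1 f.2 (z i).1 (w i).1).trans
    (mul_le_mul_of_nonneg_left (norm_fst_le _ : ‖(z i - w i).1‖ ≤ ‖z i - w i‖) hΦ.pos₁.le)
  have h2 := (hΦ.lipschitz f.1 f.2 (z i).2 (w i).2).trans
    (mul_le_mul_of_nonneg_left (norm_snd_le _ : ‖(z i - w i).2‖ ≤ ‖z i - w i‖) hΦ.pos₁.le)
  exact (abs_sub _ _).trans (by linarith)

lemma IsTestClass.supIncr_le (hΦ : IsTestClass Φ A₁ A₂ A₃) {n : ℕ} (ε : Fin n → ℝ)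
    (z : Fin n → E d × E d) :
    supIncr Φ ε z ≤ supSum Φ ε (fun i => (z i).2) + supSum Φ ε (fun i => (z i).1) := by
  refine Real.iSup_le (fun f => ?_)
    (add_nonneg (Real.iSup_nonneg fun _ => abs_nonneg _) (Real.iSup_nonneg fun _ => abs_nonneg _))
  simp_rw [mul_sub, Finset.sum_sub_distrib]
  exact (abs_sub _ _).trans (add_le_add (le_ciSup (hΦ.bddAbove_supSum ε _) f)
    (le_ciSup (hΦ.bddAbove_supSum ε _) f))

lemma rademacher_eq {n : ℕ} (x : Fin n → E d) :
    rademacher Φ x = 1 / (n : ℝ) * ((1 / 2 : ℝ) ^ n *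
      ∑ ξ : Fin n → ℤˣ, supSum Φ (fun i => (((ξ i : ℤˣ) : ℤ) : ℝ)) x) := rfl

lemma abs_intUnits_cast (u : ℤˣ) : |(((u : ℤˣ) : ℤ) : ℝ)| = 1 := by
  rcases Int.units_eq_one_or u with rfl | rfl <;> simp

variable {μ : Measure (E d)} [IsProbabilityMeasure μ]

lemma integrable_norm_prod (hμ : Integrable (fun x => ‖x‖) μ) :
    Integrable (fun z : E d × E d => ‖z‖) (μ.prod μ) := by
  refine Integrable.mono' ((hμ.comp_fst μ).add (hμ.comp_snd μ)) (by fun_prop)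
    (.of_forall fun z => ?_)
  rw [norm_norm, Prod.norm_def]
  exact max_le_add_of_nonneg (norm_nonneg _) (norm_nonneg _)

lemma IsTestClass.integrable_supSum (hΦ : IsTestClass Φ A₁ A₂ A₃)
    (hμ : Integrable (fun x => ‖x‖) μ) {n : ℕ} {ε : Fin n → ℝ} (hε : ∀ i, |ε i| = 1) :
    Integrable (supSum Φ ε) (Measure.pi fun _ => μ) :=
  memLp_one_iff_integrable.1 (memLp_pi_of_abs_sub_le_sum (hΦ.abs_supSum_sub_le hε)
    (memLp_one_iff_integrable.2 hμ))

lemma IsTestClass.integrable_supIncr (hΦ : IsTestClass Φ A₁ A₂ A₃)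
    (hμ : Integrable (fun x => ‖x‖) μ) {n : ℕ} {ε : Fin n → ℝ} (hε : ∀ i, |ε i| = 1) :
    Integrable (supIncr Φ ε) (Measure.pi fun _ => μ.prod μ) :=
  memLp_one_iff_integrable.1 (memLp_pi_of_abs_sub_le_sum (hΦ.abs_supIncr_sub_le hε)
    (memLp_one_iff_integrable.2 (integrable_norm_prod hμ)))

/-- Swapping the two entries of the pair wherever `ξ i = -1` preserves the product law and flips
exactly those increments. -/
lemma IsTestClass.integral_supIncr_eq (hΦ : IsTestClass Φ A₁ A₂ A₃) {n : ℕ} (ξ : Fin n → ℤˣ) :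
    ∫ z, supIncr Φ (fun i => (((ξ i : ℤˣ) : ℤ) : ℝ)) z ∂(Measure.pi fun _ => μ.prod μ)
      = ∫ z : Fin n → E d × E d, supIncr Φ 1 z ∂(Measure.pi fun _ => μ.prod μ) := by
  have hmp : MeasurePreserving
      (fun (z : Fin n → E d × E d) i => (if ξ i = 1 then id else Prod.swap) (z i))
      (Measure.pi fun _ => μ.prod μ) (Measure.pi fun _ => μ.prod μ) := by
    refine measurePreserving_pi _ _ fun i => ?_
    split_ifs
    · exact .id _
    · exact Measure.measurePreserving_swap
  have hone : ∀ i : Fin n, |(1 : Fin n → ℝ) i| = 1 := fun i => by simp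
  have hcont := continuous_of_abs_sub_le_sum (hΦ.abs_supIncr_sub_le hone)
  rw [← hmp.map_eq, integral_map hmp.aemeasurable hcont.aestronglyMeasurable, hmp.map_eq]
  refine integral_congr_ae (.of_forall fun z => ?_)
  simp only [supIncr]
  congr 1 with f
  congr 2 with i
  rcases Int.units_eq_one_or (ξ i) with h | h
  · simp [h]
  · have : (-1 : ℤˣ) ≠ 1 := by decide
    simp [h, this]

lemma IsTestClass.integral_supIncr_le (hΦ : IsTestClass Φ A₁ A₂ A₃)
    (hμ : Integrable (fun x => ‖x‖) μ) {n : ℕ} {ε : Fin n → ℝ} (hε : ∀ i, |ε i| = 1) :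
    ∫ z, supIncr Φ ε z ∂(Measure.pi fun _ => μ.prod μ)
      ≤ 2 * ∫ x, supSum Φ ε x ∂(Measure.pi fun _ => μ) := by
  have h1 : MeasurePreserving (fun (z : Fin n → E d × E d) i => (z i).1)
      (Measure.pi fun _ => μ.prod μ) (Measure.pi fun _ => μ) :=
    measurePreserving_pi _ _ fun _ => measurePreserving_fst
  have h2 : MeasurePreserving (fun (z : Fin n → E d × E d) i => (z i).2)
      (Measure.pi fun _ => μ.prod μ) (Measure.pi fun _ => μ) :=
    measurePreserving_pi _ _ fun _ => measurePreserving_snd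
  have hS := hΦ.integrable_supSum hμ hε
  have e1 := integral_map h1.aemeasurable (h1.map_eq ▸ hS.aestronglyMeasurable)
  have e2 := integral_map h2.aemeasurable (h2.map_eq ▸ hS.aestronglyMeasurable)
  rw [h1.map_eq] at e1
  rw [h2.map_eq] at e2
  have i1 := h1.integrable_comp_of_integrable hS
  have i2 := h2.integrable_comp_of_integrable hS
  calc _ ≤ ∫ z : Fin n → E d × E d, (supSum Φ ε (fun i => (z i).2)
        + supSum Φ ε (fun i => (z i).1)) ∂(Measure.pi fun _ => μ.prod μ) :=
        integral_mono (hΦ.integrable_supIncr hμ hε) (i2.add i1) (hΦ.supIncr_le ε)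
    _ = _ := by
        rw [two_mul]
        nth_rewrite 1 [e2]
        rw [e1]
        exact integral_add i2 i1

/-- The Rademacher average dominates the mean increment supremum. -/
lemma IsTestClass.integral_supIncr_one_le (hΦ : IsTestClass Φ A₁ A₂ A₃)
    (hμ : Integrable (fun x => ‖x‖) μ) {n : ℕ} :
    1 / (n : ℝ) * ∫ z, supIncr Φ 1 z ∂(Measure.pi fun _ : Fin n => μ.prod μ)
      ≤ 2 * ∫ x, rademacher Φ x ∂(Measure.pi fun _ : Fin n => μ) := by
  -- The weights of the sign vectors sum to one, so a quantity free of `ξ` equals its average over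
  -- `ξ`.
  have hcard : ((1 : ℝ) / 2) ^ n * ∑ _ξ : Fin n → ℤˣ, (1 : ℝ) = 1 := by
    simp only [Finset.sum_const, Finset.card_univ, Fintype.card_pi, Finset.prod_const,
      Fintype.card_units_int, Fintype.card_fin, nsmul_eq_mul, mul_one]
    push_cast
    rw [← mul_pow]
    norm_num
  have hi (ξ : Fin n → ℤˣ) := hΦ.integrable_supSum hμ
    (ε := fun i => (((ξ i : ℤˣ) : ℤ) : ℝ)) fun i => abs_intUnits_cast _
  simp_rw [rademacher_eq]
  rw [integral_const_mul, integral_const_mul, integral_finsetSum _ fun ξ _ => hi ξ]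
  calc _ = 1 / (n : ℝ) * (((1 : ℝ) / 2) ^ n * ∑ _ξ : Fin n → ℤˣ,
        ∫ z, supIncr Φ 1 z ∂(Measure.pi fun _ : Fin n => μ.prod μ)) := by
        conv_lhs => rw [← one_mul (∫ z, supIncr Φ 1 z ∂_), ← hcard]
        rw [mul_assoc, Finset.sum_mul]
        simp
    _ ≤ 1 / (n : ℝ) * (((1 : ℝ) / 2) ^ n * ∑ ξ : Fin n → ℤˣ,
        2 * ∫ x, supSum Φ (fun i => (((ξ i : ℤˣ) : ℤ) : ℝ)) x ∂(Measure.pi fun _ => μ)) := by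
        gcongr with ξ
        rw [← hΦ.integral_supIncr_eq ξ]
        exact hΦ.integral_supIncr_le hμ fun i => abs_intUnits_cast _
    _ = _ := by
        rw [← Finset.mul_sum]
        ring

/-- Jensen's inequality here is just nonnegativity of the variance of `√g`. -/
lemma integral_sqrt_le {X : Type*} [MeasurableSpace X] {ν : Measure X} [IsProbabilityMeasure ν]
    {g : X → ℝ} (hg : Integrable g ν) (h0 : ∀ x, 0 ≤ g x) :
    ∫ x, √(g x) ∂ν ≤ √(∫ x, g x ∂ν) := by
  refine Real.le_sqrt_of_sq_le ?_
  have hm : MemLp (fun x => √(g x)) 2 ν := by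
    rw [memLp_two_iff_integrable_sq hg.aestronglyMeasurable.aemeasurable.sqrt.aestronglyMeasurable]
    simpa [Real.sq_sqrt (h0 _)] using hg
  have := variance_nonneg (fun x => √(g x)) ν
  rw [variance_eq_sub hm] at this
  simpa [Real.sq_sqrt (h0 _)] using this

lemma IsTestClass.integral_rademacher_le (hΦ : IsTestClass Φ A₁ A₂ A₃)
    (hμ : MemLp (fun x => ‖x‖) 2 μ) {n : ℕ} (hn : 1 ≤ n) :
    ∫ x, rademacher Φ x ∂(Measure.pi fun _ : Fin n => μ)
      ≤ A₃ / √(n : ℝ) * √(∫ x, (‖x‖ ^ 2 + 1) ∂μ) := by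
  have hμ1 : Integrable (fun x => ‖x‖) μ := hμ.integrable (by norm_num)
  have hM : Integrable (fun x : E d => ‖x‖ ^ 2 + 1) μ :=
    hμ.integrable_sq.add (integrable_const _)
  have hMi (i : Fin n) : Integrable (fun x : Fin n → E d => ‖x i‖ ^ 2 + 1)
      (Measure.pi fun _ : Fin n => μ) :=
    (measurePreserving_eval (fun _ : Fin n => μ) i).integrable_comp_of_integrable hM
  have hsum : Integrable (fun x : Fin n → E d => ∑ i, (‖x i‖ ^ 2 + 1))
      (Measure.pi fun _ : Fin n => μ) := integrable_finsetSum _ fun i _ => hMi i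
  have hsumeq : ∫ x : Fin n → E d, ∑ i, (‖x i‖ ^ 2 + 1) ∂(Measure.pi fun _ : Fin n => μ)
      = (n : ℝ) * ∫ x, (‖x‖ ^ 2 + 1) ∂μ := by
    rw [integral_finsetSum _ fun i _ => hMi i]
    have : ∀ i : Fin n, ∫ x : Fin n → E d, (‖x i‖ ^ 2 + 1) ∂(Measure.pi fun _ : Fin n => μ)
        = ∫ x, (‖x‖ ^ 2 + 1) ∂μ := fun i =>
      integral_comp_eval (μ := fun _ : Fin n => μ) (i := i) (f := fun x => ‖x‖ ^ 2 + 1)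
        hM.aestronglyMeasurable
    simp [this]
  have hsqrt : Integrable (fun x : Fin n → E d => √(∑ i, (‖x i‖ ^ 2 + 1)))
      (Measure.pi fun _ : Fin n => μ) := by
    refine (hsum.add (integrable_const (1 : ℝ)))
      |>.mono' hsum.aestronglyMeasurable.aemeasurable.sqrt.aestronglyMeasurable
      (.of_forall fun x => ?_)
    have h0 : 0 ≤ ∑ i, (‖x i‖ ^ 2 + 1) := Finset.sum_nonneg fun i _ => by positivity
    rw [Real.norm_eq_abs, abs_of_nonneg (Real.sqrt_nonneg _)]
    simp only [Pi.add_apply]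
    nlinarith [Real.sq_sqrt h0, sq_nonneg (√(∑ i, (‖x i‖ ^ 2 + 1)) - 1),
      Real.sqrt_nonneg (∑ i, (‖x i‖ ^ 2 + 1))]
  have hrad : Integrable (rademacher Φ) (Measure.pi fun _ : Fin n => μ) := by
    refine Integrable.const_mul (Integrable.const_mul (integrable_finsetSum _ fun ξ _ => ?_) _) _
    exact hΦ.integrable_supSum hμ1 (ε := fun i => (((ξ i : ℤˣ) : ℤ) : ℝ))
      fun i => abs_intUnits_cast _
  have hnpos : (0 : ℝ) < n := by exact_mod_cast hn
  calc _ ≤ ∫ x : Fin n → E d, A₃ / n * √(∑ i, (‖x i‖ ^ 2 + 1)) ∂(Measure.pi fun _ => μ) :=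
        integral_mono hrad (hsqrt.const_mul _) (hΦ.rademacher_le n hn)
    _ ≤ A₃ / n * √((n : ℝ) * ∫ x, (‖x‖ ^ 2 + 1) ∂μ) := by
        rw [integral_const_mul, ← hsumeq]
        exact mul_le_mul_of_nonneg_left
          (integral_sqrt_le hsum fun x => Finset.sum_nonneg fun i _ => by positivity)
          (div_nonneg hΦ.pos₃.le hnpos.le)
    _ = _ := by
        rw [Real.sqrt_mul hnpos.le, ← mul_assoc]
        congr 1
        have := Real.sq_sqrt hnpos.le
        field_simp
        rw [this]

lemma integral_empirical {n : ℕ} (f : E d → ℝ) (x : Fin n → E d) :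
    ∫ y, f y ∂(empirical x) = 1 / (n : ℝ) * ∑ i, f (x i) := by
  rw [empirical, integral_smul_measure, integral_finsetSum_measure]
  · simp
  · intro i _
    exact integrable_dirac (by simp)

instance isProbabilityMeasure_empirical {n : ℕ} [NeZero n] (x : Fin n → E d) :
    IsProbabilityMeasure (empirical x) := by
  constructor
  simp [empirical, ENNReal.inv_mul_cancel, NeZero.ne n]

lemma integrable_norm_empirical {n : ℕ} [NeZero n] (x : Fin n → E d) :
    Integrable (fun y => ‖y‖) (empirical x) := by
  refine Integrable.smul_measure ?_ (by simp [NeZero.ne n])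
  exact integrable_finsetSum_measure.2 fun i _ => integrable_dirac (by simp)

/-- The `∫ f dμ` terms cancel, leaving an average of `n` increments. The constant `A₁ / n` drives
both the variance and the deviation bound. -/
lemma IsTestClass.abs_gmmd_empirical_sub_le (hΦ : IsTestClass Φ A₁ A₂ A₃)
    (hμ : Integrable (fun x => ‖x‖) μ) {n : ℕ} (hn : 1 ≤ n) (x y : Fin n → E d) :
    |gmmd Φ μ (empirical x) - gmmd Φ μ (empirical y)| ≤ A₁ / n * ∑ i, ‖x i - y i‖ := by
  have : NeZero n := ⟨by omega⟩
  refine abs_iSup_sub_iSup_le (hΦ.bddAbove_gmmd hμ (integrable_norm_empirical x))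
    (hΦ.bddAbove_gmmd hμ (integrable_norm_empirical y))
    (mul_nonneg (div_nonneg hΦ.pos₁.le n.cast_nonneg)
      (Finset.sum_nonneg fun _ _ => norm_nonneg _)) fun f => ?_
  refine (abs_abs_sub_abs_le_abs_sub _ _).trans ?_
  rw [integral_empirical, integral_empirical, sub_sub_sub_cancel_left, ← mul_sub,
    ← Finset.sum_sub_distrib, abs_mul, abs_of_nonneg (by positivity : (0 : ℝ) ≤ 1 / n),
    one_div_mul_eq_div, div_mul_eq_mul_div, Finset.mul_sum]
  gcongr
  refine (Finset.abs_sum_le_sum_abs _ _).trans (Finset.sum_le_sum fun i _ => ?_)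
  rw [norm_sub_rev]
  exact hΦ.lipschitz f.1 f.2 _ _

/-- Ghost sample: `∫ f dμ` is the expected empirical mean of an independent copy `y`, and a supremum
of expectations is at most the expectation of the supremum. -/
lemma IsTestClass.gmmd_empirical_le (hΦ : IsTestClass Φ A₁ A₂ A₃)
    (hμ : Integrable (fun x => ‖x‖) μ) {n : ℕ} (hn : 1 ≤ n) (x : Fin n → E d)
    (hx : Integrable (fun y : Fin n → E d => supIncr Φ 1 fun i => (x i, y i))
      (Measure.pi fun _ => μ)) :
    gmmd Φ μ (empirical x)
      ≤ 1 / (n : ℝ) * ∫ y, supIncr Φ 1 (fun i => (x i, y i)) ∂(Measure.pi fun _ => μ) := by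
  have hnpos : (0 : ℝ) < n := by exact_mod_cast hn
  refine Real.iSup_le (fun f => ?_)
    (mul_nonneg (by positivity) (integral_nonneg fun y => supIncr_nonneg _ _))
  have hf := hΦ.integrable f.2 hμ
  have hfi (i : Fin n) : Integrable (fun y : Fin n → E d => f.1 (y i) - f.1 (x i))
      (Measure.pi fun _ => μ) :=
    ((measurePreserving_eval (fun _ : Fin n => μ) i).integrable_comp_of_integrable hf).sub
      (integrable_const _)
  have heq : ∫ y, ∑ i, (f.1 (y i) - f.1 (x i)) ∂(Measure.pi fun _ : Fin n => μ)
      = n * ∫ z, f.1 z ∂μ - ∑ i, f.1 (x i) := by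
    rw [integral_finsetSum _ fun i _ => hfi i]
    have (i : Fin n) : ∫ y, (f.1 (y i) - f.1 (x i)) ∂(Measure.pi fun _ : Fin n => μ)
        = ∫ z, f.1 z ∂μ - f.1 (x i) := by
      rw [integral_comp_eval (μ := fun _ : Fin n => μ) (i := i) (f := fun z => f.1 z - f.1 (x i))
        (hf.sub (integrable_const _)).aestronglyMeasurable, integral_sub hf (integrable_const _)]
      simp
    simp [this, Finset.sum_sub_distrib]
  have hsub : (∫ z, f.1 z ∂μ) - 1 / (n : ℝ) * ∑ i, f.1 (x i)
      = 1 / n * ∫ y, ∑ i, (f.1 (y i) - f.1 (x i)) ∂(Measure.pi fun _ : Fin n => μ) := by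
    rw [heq]
    field_simp
  rw [integral_empirical, hsub, abs_mul, abs_of_nonneg (by positivity : (0 : ℝ) ≤ 1 / n)]
  gcongr
  refine abs_integral_le_integral_abs.trans (integral_mono
    (integrable_finsetSum _ fun i _ => hfi i).abs hx fun y => ?_)
  simpa only [supIncr, Pi.one_apply, one_mul] using le_ciSup (hΦ.bddAbove_supIncr 1 fun i => (x i, y i)) f

/-- The symmetrization bound for the mean discrepancy of the empirical measure. -/
lemma IsTestClass.integral_gmmd_empirical_le (hΦ : IsTestClass Φ A₁ A₂ A₃)
    (hμ : MemLp (fun x => ‖x‖) 2 μ) {n : ℕ} (hn : 1 ≤ n) :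
    ∫ x, gmmd Φ μ (empirical x) ∂(Measure.pi fun _ : Fin n => μ)
      ≤ 2 * A₃ / √(n : ℝ) * √(∫ x, (‖x‖ ^ 2 + 1) ∂μ) := by
  have hμ1 : Integrable (fun x => ‖x‖) μ := hμ.integrable (by norm_num)
  have hone : ∀ i : Fin n, |(1 : Fin n → ℝ) i| = 1 := fun i => by simp
  have hD : Integrable (fun x : Fin n → E d => gmmd Φ μ (empirical x)) (Measure.pi fun _ => μ) :=
    memLp_one_iff_integrable.1 (memLp_pi_of_abs_sub_le_sum (hΦ.abs_gmmd_empirical_sub_le hμ1 hn)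
      (memLp_one_iff_integrable.2 hμ1))
  -- A pair of independent samples is a sample of independent pairs.
  have hmp := (measurePreserving_arrowProdEquivProdArrow (E d) (E d) (Fin n)
    (fun _ => μ) (fun _ => μ)).symm
  have hS := hΦ.integrable_supIncr hμ1 hone
  have hS' : Integrable (fun p : (Fin n → E d) × (Fin n → E d) =>
      supIncr Φ 1 fun i => (p.1 i, p.2 i))
      ((Measure.pi fun _ => μ).prod (Measure.pi fun _ => μ)) :=
    hmp.integrable_comp_of_integrable hS
  have heq : ∫ x : Fin n → E d, ∫ y : Fin n → E d, supIncr Φ 1 (fun i => (x i, y i))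
        ∂(Measure.pi fun _ => μ) ∂(Measure.pi fun _ => μ)
      = ∫ z, supIncr Φ 1 z ∂(Measure.pi fun _ : Fin n => μ.prod μ) := by
    rw [← hmp.integral_comp', ← integral_prod _ hS']
    rfl
  -- Fubini would give this only for almost every `x`; the Lipschitz bound gives it for all.
  have hx (x : Fin n → E d) : Integrable (fun y : Fin n → E d => supIncr Φ 1 fun i => (x i, y i))
      (Measure.pi fun _ => μ) := by
    refine memLp_one_iff_integrable.1 (memLp_pi_of_abs_sub_le_sum (L := 2 * A₁) (fun y y' => ?_)
      (memLp_one_iff_integrable.2 hμ1))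
    simpa [Prod.norm_def] using hΦ.abs_supIncr_sub_le hone
      (fun i => (x i, y i)) (fun i => (x i, y' i))
  calc _ ≤ ∫ x : Fin n → E d, 1 / (n : ℝ) * ∫ y : Fin n → E d, supIncr Φ 1 (fun i => (x i, y i))
          ∂(Measure.pi fun _ => μ) ∂(Measure.pi fun _ => μ) :=
        integral_mono hD (hS'.integral_prod_left.const_mul _) fun x =>
          hΦ.gmmd_empirical_le hμ1 hn x (hx x)
    _ = 1 / (n : ℝ) * ∫ z, supIncr Φ 1 z ∂(Measure.pi fun _ : Fin n => μ.prod μ) := by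
        rw [integral_const_mul, heq]
    _ ≤ 2 * ∫ x, rademacher Φ x ∂(Measure.pi fun _ : Fin n => μ) :=
        hΦ.integral_supIncr_one_le hμ1
    _ ≤ 2 * (A₃ / √(n : ℝ) * √(∫ x, (‖x‖ ^ 2 + 1) ∂μ)) := by
        gcongr
        exact hΦ.integral_rademacher_le hμ hn
    _ = _ := by ring

end TestClass

/-! ### Wasserstein comparisons and the metric property -/

section Wasserstein

variable {d : ℕ}

lemma integrable_norm_of_mem_finiteMoment {μ : Measure (E d)} (hμ : μ ∈ finiteMoment d 1) :
    Integrable (fun x => ‖x‖) μ := by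
  refine ⟨by fun_prop, ?_⟩
  simpa [HasFiniteIntegral] using hμ.2

lemma memLp_norm_of_mem_finiteMoment {μ : Measure (E d)} (hμ : μ ∈ finiteMoment d 2) :
    MemLp (fun x => ‖x‖) 2 μ := by
  refine ⟨by fun_prop, ?_⟩
  rw [eLpNorm_lt_top_iff_lintegral_rpow_enorm_lt_top (by norm_num) (by norm_num)]
  simpa using hμ.2

lemma mem_finiteMoment_two {μ : Measure (E d)} [IsProbabilityMeasure μ]
    (hμ : MemLp (fun x => ‖x‖) 2 μ) : μ ∈ finiteMoment d 2 := by
  refine ⟨‹_›, ?_⟩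
  have := hμ.2
  rw [eLpNorm_lt_top_iff_lintegral_rpow_enorm_lt_top (by norm_num) (by norm_num)] at this
  simpa using this

lemma wasserstein_one (μ ν : Measure (E d)) :
    wasserstein 1 μ ν = ⨅ γ ∈ couplings μ ν, ∫⁻ z, ‖z.1 - z.2‖ₑ ∂γ := by
  simp [wasserstein]

/-- The easy half of Kantorovich–Rubinstein duality. -/
lemma ofReal_abs_integral_sub_le {L : ℝ} (hL : 0 < L) {f : E d → ℝ}
    (hf : ∀ x y, |f x - f y| ≤ L * ‖x - y‖) {μ ν : Measure (E d)} (hμ : Integrable f μ)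
    (hν : Integrable f ν) :
    ENNReal.ofReal |∫ x, f x ∂μ - ∫ x, f x ∂ν| ≤ ENNReal.ofReal L * wasserstein 1 μ ν := by
  -- A finite nonzero factor passes through an infimum in `[0, ∞]`, even an empty one of value `∞`.
  have h0 : ENNReal.ofReal L ≠ 0 := by simpa using hL
  rw [wasserstein_one, ENNReal.mul_iInf_of_ne h0 ENNReal.ofReal_ne_top]
  refine le_iInf fun γ => ?_
  rw [ENNReal.mul_iInf_of_ne h0 ENNReal.ofReal_ne_top]
  refine le_iInf fun ⟨_, h1, h2⟩ => ?_
  have m1 : MeasurePreserving Prod.fst γ μ := ⟨measurable_fst, h1⟩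
  have m2 : MeasurePreserving Prod.snd γ ν := ⟨measurable_snd, h2⟩
  have e1 : ∫ x, f x ∂μ = ∫ z, f z.1 ∂γ := by
    rw [← h1, integral_map measurable_fst.aemeasurable (h1 ▸ hμ.aestronglyMeasurable)]
  have e2 : ∫ x, f x ∂ν = ∫ z, f z.2 ∂γ := by
    rw [← h2, integral_map measurable_snd.aemeasurable (h2 ▸ hν.aestronglyMeasurable)]
  have i1 : Integrable (fun z : E d × E d => f z.1) γ := m1.integrable_comp_of_integrable hμ
  have i2 : Integrable (fun z : E d × E d => f z.2) γ := m2.integrable_comp_of_integrable hν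
  rw [e1, e2, ← integral_sub i1 i2, ← Real.enorm_eq_ofReal_abs]
  refine (enorm_integral_le_lintegral_enorm _).trans ?_
  rw [← lintegral_const_mul' _ _ ENNReal.ofReal_ne_top]
  refine lintegral_mono fun z => ?_
  rw [Real.enorm_eq_ofReal_abs, ← ofReal_norm, ← ENNReal.ofReal_mul hL.le]
  exact ENNReal.ofReal_le_ofReal (hf _ _)

/-- For each coupling, which is a probability measure, the `L¹` norm of `z.1 - z.2` is at most its
`L²` norm. -/
lemma wasserstein_one_le_two (μ ν : Measure (E d)) :
    wasserstein 1 μ ν ≤ wasserstein 2 μ ν := by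
  rw [wasserstein_one, wasserstein, one_div, ENNReal.le_rpow_inv_iff (by norm_num)]
  refine le_iInf₂ fun γ hγ => ?_
  have := hγ.1
  refine (ENNReal.rpow_le_rpow (iInf₂_le γ hγ) (by norm_num)).trans ?_
  rw [← ENNReal.le_rpow_inv_iff (by norm_num)]
  have h := eLpNorm_le_eLpNorm_of_exponent_le (μ := γ) (p := 1) (q := 2)
    (f := fun z : E d × E d => z.1 - z.2) (by norm_num) (by fun_prop)
  rw [eLpNorm_one_eq_lintegral_enorm,
    eLpNorm_eq_lintegral_rpow_enorm_toReal (by norm_num) (by norm_num)] at h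
  simpa using h

variable {Φ : Set (E d → ℝ)} {A₁ A₂ A₃ : ℝ}

lemma gmmd_nonneg (μ ν : Measure (E d)) : 0 ≤ gmmd Φ μ ν :=
  Real.iSup_nonneg fun _ => abs_nonneg _

lemma IsTestClass.isMetricOn_gmmd (hΦ : IsTestClass Φ A₁ A₂ A₃) :
    IsMetricOn (finiteMoment d 1) (gmmd Φ) where
  nonneg μ _ ν _ := gmmd_nonneg μ ν
  eq_zero_iff μ hμ ν hν := by
    have := hμ.1
    have := hν.1
    have hμ' := integrable_norm_of_mem_finiteMoment hμ
    have hν' := integrable_norm_of_mem_finiteMoment hν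
    refine ⟨fun h => ?_, fun h => by simp [h, gmmd]⟩
    rw [← Measure.toSignedMeasure_eq_toSignedMeasure_iff, ← sub_eq_zero]
    refine hΦ.separating _ fun f hf => ?_
    have iμ : μ.toSignedMeasure.Integrable f := by
      simpa [VectorMeasure.Integrable] using hΦ.integrable hf hμ'
    have iν : ν.toSignedMeasure.Integrable f := by
      simpa [VectorMeasure.Integrable] using hΦ.integrable hf hν'
    refine ⟨iμ.sub_vectorMeasure iν, ?_⟩
    rw [VectorMeasure.integral_sub_vectorMeasure iμ iν, VectorMeasure.integral_toSignedMeasure,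
      VectorMeasure.integral_toSignedMeasure]
    have := le_ciSup (hΦ.bddAbove_gmmd hμ' hν') ⟨f, hf⟩
    exact abs_nonpos_iff.1 (this.trans h.le)
  symm μ _ ν _ := by simp only [gmmd, abs_sub_comm]
  triangle μ hμ ν hν ρ hρ := by
    have := hμ.1
    have := hν.1
    have := hρ.1
    have hμ' := integrable_norm_of_mem_finiteMoment hμ
    have hν' := integrable_norm_of_mem_finiteMoment hν
    have hρ' := integrable_norm_of_mem_finiteMoment hρ
    refine Real.iSup_le (fun f => ?_) (add_nonneg (gmmd_nonneg _ _) (gmmd_nonneg _ _))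
    exact (abs_sub_le _ _ _).trans (add_le_add (le_ciSup (hΦ.bddAbove_gmmd hμ' hν') f)
      (le_ciSup (hΦ.bddAbove_gmmd hν' hρ') f))

lemma IsTestClass.gmmd_le_wasserstein (hΦ : IsTestClass Φ A₁ A₂ A₃) {μ ν : Measure (E d)}
    (hμ : μ ∈ finiteMoment d 1) (hν : ν ∈ finiteMoment d 1) :
    ENNReal.ofReal (gmmd Φ μ ν) ≤ ENNReal.ofReal A₁ * wasserstein 1 μ ν := by
  have := hμ.1
  have := hν.1
  -- With the infinite case removed, the bound can be tested on each member of the real supremum.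
  rcases eq_or_ne (wasserstein 1 μ ν) ∞ with h | h
  · rw [h, ENNReal.mul_top (by simpa using hΦ.pos₁)]
    exact le_top
  have hfin := ENNReal.mul_ne_top (ENNReal.ofReal_ne_top (r := A₁)) h
  rw [ENNReal.ofReal_le_iff_le_toReal hfin]
  refine Real.iSup_le (fun f => ?_) ENNReal.toReal_nonneg
  rw [← ENNReal.ofReal_le_iff_le_toReal hfin]
  exact ofReal_abs_integral_sub_le hΦ.pos₁ (hΦ.lipschitz f.1 f.2)
    (hΦ.integrable f.2 (integrable_norm_of_mem_finiteMoment hμ))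
    (hΦ.integrable f.2 (integrable_norm_of_mem_finiteMoment hν))

end Wasserstein

/-! ### Relative entropy of exponentially tilted measures -/

section Tilted

variable {X : Type*} [MeasurableSpace X] {μ : Measure X} [IsProbabilityMeasure μ] {f : X → ℝ}

lemma llr_tilted_self (hexp : Integrable (fun x => Real.exp (f x)) μ) :
    llr (μ.tilted f) μ =ᵐ[μ.tilted f] fun x => f x - Real.log (∫ x, Real.exp (f x) ∂μ) :=
  (tilted_absolutelyContinuous μ f).ae_le (log_rnDeriv_tilted_left_self hexp)

lemma klDiv_tilted_ne_top (hexp : Integrable (fun x => Real.exp (f x)) μ)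
    (hf : Integrable f (μ.tilted f)) : InformationTheory.klDiv (μ.tilted f) μ ≠ ∞ := by
  have := isProbabilityMeasure_tilted hexp
  refine InformationTheory.klDiv_ne_top (tilted_absolutelyContinuous μ f) ?_
  rw [integrable_congr (llr_tilted_self hexp)]
  exact hf.sub (integrable_const _)

/-- The equality case of the Gibbs variational principle, which turns an entropy bound into a bound
on `log ∫ e^f dμ`. -/
lemma toReal_klDiv_tilted (hexp : Integrable (fun x => Real.exp (f x)) μ)
    (hf : Integrable f (μ.tilted f)) :
    (InformationTheory.klDiv (μ.tilted f) μ).toReal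
      = ∫ x, f x ∂(μ.tilted f) - Real.log (∫ x, Real.exp (f x) ∂μ) := by
  have := isProbabilityMeasure_tilted hexp
  rw [InformationTheory.toReal_klDiv_of_measure_eq (tilted_absolutelyContinuous μ f) (by simp),
    integral_congr_ae (llr_tilted_self hexp), integral_sub hf (integrable_const _)]
  simp

end Tilted

/-! ### From the `T₁` inequality to Gaussian concentration -/

section Transport

variable {d : ℕ}

/-- Some coupling has finite cost, and `‖z.1‖ ≤ ‖z.1 - z.2‖ + ‖z.2‖`. -/
lemma integrable_norm_of_wasserstein_ne_top {μ ν : Measure (E d)}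
    (h : wasserstein 1 μ ν ≠ ∞) (hν : Integrable (fun x => ‖x‖) ν) :
    Integrable (fun x => ‖x‖) μ := by
  rw [wasserstein_one, ← lt_top_iff_ne_top] at h
  obtain ⟨γ, h⟩ := iInf_lt_iff.1 h
  obtain ⟨⟨_, h1, h2⟩, h⟩ := iInf_lt_iff.1 h
  refine ⟨by fun_prop, ?_⟩
  have hν2 : ∫⁻ z, ‖z.2‖ₑ ∂γ < ∞ := by
    have := hν.2
    rw [HasFiniteIntegral, ← h2, lintegral_map (by fun_prop) measurable_snd] at this
    simpa using this
  rw [HasFiniteIntegral, ← h1, lintegral_map (by fun_prop) measurable_fst]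
  simp only [enorm_norm]
  calc ∫⁻ z, ‖z.1‖ₑ ∂γ ≤ ∫⁻ z, (‖z.1 - z.2‖ₑ + ‖z.2‖ₑ) ∂γ := by
        refine lintegral_mono fun z => ?_
        simpa using enorm_add_le (z.1 - z.2) z.2
    _ = ∫⁻ z, ‖z.1 - z.2‖ₑ ∂γ + ∫⁻ z, ‖z.2‖ₑ ∂γ := lintegral_add_right _ (by fun_prop)
    _ < ∞ := ENNReal.add_lt_top.2 ⟨h, hν2⟩

lemma SatisfiesT1.wasserstein_ne_top {μ : Measure (E d)} {κ : ℝ}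
    (hT : SatisfiesT1 κ μ) {ν : Measure (E d)}
    [IsProbabilityMeasure ν] (hν : ν ≪ μ) (hK : InformationTheory.klDiv ν μ ≠ ∞) :
    wasserstein 1 μ ν ≠ ∞ := by
  have h := (hT ν ‹_› hν).trans_lt (ENNReal.mul_lt_top ENNReal.ofReal_lt_top hK.lt_top)
  rw [ENNReal.pow_lt_top_iff] at h
  exact (h.resolve_right two_ne_zero).ne

variable {μ : Measure (E d)} [IsProbabilityMeasure μ] {κ : ℝ}

/-- No moment is assumed. The tilt by `-‖x‖` has a first moment because `t e^(-t) ≤ 1`, and so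
finite entropy; `T₁` puts it at finite distance from `μ`, which inherits the moment. -/
lemma SatisfiesT1.integrable_norm (hT : SatisfiesT1 κ μ) : Integrable (fun x => ‖x‖) μ := by
  have hexp : Integrable (fun x : E d => Real.exp (-‖x‖)) μ :=
    (integrable_const (1 : ℝ)).mono' (by fun_prop) (.of_forall fun x => by simp)
  have := isProbabilityMeasure_tilted hexp
  have hn : Integrable (fun x => ‖x‖) (μ.tilted fun x => -‖x‖) := by
    rw [integrable_tilted_iff hexp]
    refine (integrable_const (1 : ℝ)).mono' (by fun_prop) (.of_forall fun x => ?_)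
    have h1 := Real.add_one_le_exp ‖x‖
    have h2 := Real.exp_pos ‖x‖
    rw [smul_eq_mul, Real.norm_eq_abs, abs_of_nonneg (by positivity), Real.exp_neg,
      inv_mul_le_one₀ h2]
    linarith
  exact integrable_norm_of_wasserstein_ne_top
    (hT.wasserstein_ne_top (tilted_absolutelyContinuous μ _) (klDiv_tilted_ne_top hexp hn.neg)) hn

/-- The Bobkov–Götze bound for bounded Lipschitz functions. -/
lemma SatisfiesT1.log_integral_exp_le (hT : SatisfiesT1 κ μ) (hκ : 0 < κ) {L : ℝ} (hL : 0 < L)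
    {f : E d → ℝ} (hf : ∀ x y, |f x - f y| ≤ L * ‖x - y‖) {B : ℝ} (hB : ∀ x, |f x| ≤ B) :
    Real.log (∫ x, Real.exp (f x) ∂μ) ≤ ∫ x, f x ∂μ + κ ^ 2 * L ^ 2 / 2 := by
  have hc := continuous_of_abs_sub_le_norm hf
  have hexp : Integrable (fun x => Real.exp (f x)) μ :=
    (integrable_const (Real.exp B)).mono' (by fun_prop) (.of_forall fun x => by
      simpa using (abs_le.1 (hB x)).2)
  have := isProbabilityMeasure_tilted hexp
  have hint {ν : Measure (E d)} [IsProbabilityMeasure ν] : Integrable f ν :=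
    (integrable_const B).mono' hc.aestronglyMeasurable (.of_forall hB)
  have hac := tilted_absolutelyContinuous μ f
  have hK := klDiv_tilted_ne_top hexp hint
  have hKeq := toReal_klDiv_tilted hexp hint
  have hW := hT.wasserstein_ne_top hac hK
  have h1 := ofReal_abs_integral_sub_le hL hf (hint (ν := μ)) (hint (ν := μ.tilted f))
  rw [ENNReal.ofReal_le_iff_le_toReal (ENNReal.mul_ne_top ENNReal.ofReal_ne_top hW),
    ENNReal.toReal_mul, ENNReal.toReal_ofReal hL.le] at h1
  have h2 := ENNReal.toReal_mono (ENNReal.mul_ne_top ENNReal.ofReal_ne_top hK) (hT _ ‹_› hac)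
  rw [ENNReal.toReal_mul, ENNReal.toReal_pow, ENNReal.toReal_ofReal (by positivity), hKeq] at h2
  set w := (wasserstein 1 μ (μ.tilted f)).toReal
  set I := ∫ x, f x ∂(μ.tilted f)
  set Z := Real.log (∫ x, Real.exp (f x) ∂μ)
  have h3 := (abs_le.1 h1).1
  -- The entropy of the tilt is `I - Z`, so `T₁` reads `w² ≤ 2κ² (I - Z)`; Young's inequality, a
  -- completed square, trades `L * w` for `w² / (2κ²)`. Combined with `I - L * w ≤ ∫ f dμ`, the term
  -- `I` cancels.
  have h4 : L * w ≤ κ ^ 2 * L ^ 2 / 2 + (I - Z) := by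
    have h5 : w ^ 2 / (2 * κ ^ 2) ≤ I - Z := by
      rw [div_le_iff₀ (by positivity)]
      linarith
    have h6 : L * w ≤ κ ^ 2 * L ^ 2 / 2 + w ^ 2 / (2 * κ ^ 2) := by
      have : κ ^ 2 * L ^ 2 / 2 + w ^ 2 / (2 * κ ^ 2) - L * w
          = (κ ^ 2 * L - w) ^ 2 / (2 * κ ^ 2) := by
        field_simp
        ring
      have := (by positivity : 0 ≤ (κ ^ 2 * L - w) ^ 2 / (2 * κ ^ 2))
      linarith
    linarith
  linarith

/-- The Bobkov–Götze bound for Lipschitz functions. -/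
lemma SatisfiesT1.lintegral_exp_le (hT : SatisfiesT1 κ μ) (hκ : 0 < κ) {L : ℝ} (hL : 0 < L)
    {f : E d → ℝ} (hf : ∀ x y, |f x - f y| ≤ L * ‖x - y‖) :
    ∫⁻ x, ENNReal.ofReal (Real.exp (f x)) ∂μ
      ≤ ENNReal.ofReal (Real.exp (∫ x, f x ∂μ + κ ^ 2 * L ^ 2 / 2)) := by
  have hc := continuous_of_abs_sub_le_norm hf
  have hfi : Integrable f μ := memLp_one_iff_integrable.1
    (memLp_of_abs_sub_le_norm hf (memLp_one_iff_integrable.2 hT.integrable_norm))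
  -- Truncation keeps the Lipschitz constant. Fatou's lemma handles the exponential integrals,
  -- dominated convergence the means.
  set g : ℕ → E d → ℝ := fun N x => max (min (f x) N) (-N) with hg
  have hgc (N : ℕ) : Continuous (g N) := by fun_prop
  have hgl (N : ℕ) (x y : E d) : |g N x - g N y| ≤ L * ‖x - y‖ :=
    (abs_max_sub_max_le_abs _ _ _).trans ((abs_min_sub_min_le_max _ _ _ _).trans (by
      simpa using hf x y))
  have hgB (N : ℕ) (x : E d) : |g N x| ≤ N :=
    abs_le.2 ⟨le_max_right _ _, max_le (min_le_right _ _) (by simp)⟩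
  have hgf (N : ℕ) (x : E d) : |g N x| ≤ |f x| := by
    have h0 : (0 : ℝ) ≤ N := N.cast_nonneg
    simp only [hg]
    grind
  have hlim (x : E d) : ∀ᶠ N : ℕ in Filter.atTop, g N x = f x := by
    obtain ⟨M, hM⟩ := exists_nat_ge |f x|
    filter_upwards [Filter.eventually_ge_atTop M] with N hN
    have hN' : |f x| ≤ N := hM.trans (by exact_mod_cast hN)
    rw [abs_le] at hN'
    simp [hg, min_eq_left hN'.2, max_eq_left hN'.1]
  have hbound (N : ℕ) : ∫⁻ x, ENNReal.ofReal (Real.exp (g N x)) ∂μ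
      ≤ ENNReal.ofReal (Real.exp (∫ x, g N x ∂μ + κ ^ 2 * L ^ 2 / 2)) := by
    have hi : Integrable (fun x => Real.exp (g N x)) μ :=
      (integrable_const (Real.exp N)).mono' (by fun_prop) (.of_forall fun x => by
        simpa using (abs_le.1 (hgB N x)).2)
    rw [← ofReal_integral_eq_lintegral_ofReal hi (.of_forall fun x => (Real.exp_pos _).le)]
    refine ENNReal.ofReal_le_ofReal ?_
    rw [← Real.log_le_iff_le_exp (integral_exp_pos hi)]
    exact hT.log_integral_exp_le hκ hL (hgl N) (hgB N)
  have hint : Filter.Tendsto (fun N => ∫ x, g N x ∂μ) Filter.atTop (nhds (∫ x, f x ∂μ)) :=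
    tendsto_integral_of_dominated_convergence (fun x => |f x|)
      (fun N => (hgc N).aestronglyMeasurable) hfi.abs (fun N => .of_forall (hgf N))
      (.of_forall fun x => tendsto_const_nhds.congr' ((hlim x).mono fun _ h => h.symm))
  have hrhs : Filter.Tendsto
      (fun N => ENNReal.ofReal (Real.exp (∫ x, g N x ∂μ + κ ^ 2 * L ^ 2 / 2))) Filter.atTop
      (nhds (ENNReal.ofReal (Real.exp (∫ x, f x ∂μ + κ ^ 2 * L ^ 2 / 2)))) :=
    ENNReal.tendsto_ofReal ((Real.continuous_exp.tendsto _).comp (hint.add_const _))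
  calc ∫⁻ x, ENNReal.ofReal (Real.exp (f x)) ∂μ
      = ∫⁻ x, Filter.liminf (fun N => ENNReal.ofReal (Real.exp (g N x))) Filter.atTop ∂μ := by
        refine lintegral_congr fun x => (Filter.Tendsto.liminf_eq ?_).symm
        exact tendsto_const_nhds.congr' ((hlim x).mono fun _ h => by simp [h])
    _ ≤ Filter.liminf (fun N => ∫⁻ x, ENNReal.ofReal (Real.exp (g N x)) ∂μ) Filter.atTop :=
        lintegral_liminf_le fun N => by fun_prop
    _ ≤ Filter.liminf (fun N => ENNReal.ofReal
          (Real.exp (∫ x, g N x ∂μ + κ ^ 2 * L ^ 2 / 2))) Filter.atTop :=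
        Filter.liminf_le_liminf (.of_forall hbound)
    _ = _ := hrhs.liminf_eq

/-- The norm is 1-Lipschitz, so `e^‖x‖` is integrable, and it dominates `‖x‖² / 2`. -/
lemma SatisfiesT1.memLp_norm (hT : SatisfiesT1 κ μ) (hκ : 0 < κ) :
    MemLp (fun x => ‖x‖) 2 μ := by
  have h := hT.lintegral_exp_le hκ one_pos (f := fun x => ‖x‖) fun x y => by
    simpa using abs_norm_sub_norm_le x y
  have hi : Integrable (fun x : E d => Real.exp ‖x‖) μ := by
    refine ⟨by fun_prop, ?_⟩
    refine lt_of_le_of_lt (le_of_eq ?_) (h.trans_lt ENNReal.ofReal_lt_top)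
    exact lintegral_congr fun x => by rw [Real.enorm_eq_ofReal (Real.exp_pos _).le]
  rw [memLp_two_iff_integrable_sq (by fun_prop)]
  refine (hi.const_mul 2).mono' (by fun_prop) (.of_forall fun x => ?_)
  have := Real.quadratic_le_exp_of_nonneg (norm_nonneg x)
  rw [Real.norm_eq_abs, abs_of_nonneg (by positivity)]
  nlinarith [norm_nonneg x]

/-- Gaussian concentration for Lipschitz functions of independent variables satisfying `T₁`. -/
lemma SatisfiesT1.measureReal_pi_ge_le (hT : SatisfiesT1 κ μ) (hκ : 0 < κ) {L : ℝ} (hL : 0 < L)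
    {n : ℕ} (hn : 1 ≤ n) {F : (Fin n → E d) → ℝ}
    (hF : ∀ x y, |F x - F y| ≤ L * ∑ i, ‖x i - y i‖) {a : ℝ} (ha : 0 ≤ a) :
    (Measure.pi fun _ : Fin n => μ).real {x | ∫ x, F x ∂(Measure.pi fun _ => μ) + a ≤ F x}
      ≤ Real.exp (-a ^ 2 / (2 * n * κ ^ 2 * L ^ 2)) := by
  -- For `a = 0` the bound is 1. Otherwise the Chernoff parameter below is positive, as the
  -- Lipschitz constant `t * L` requires.
  rcases ha.eq_or_lt with rfl | ha
  · simp [measureReal_le_one]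
  have hnpos : (0 : ℝ) < n := by exact_mod_cast hn
  -- The minimizer of the exponent `-t a + n κ² (t L)² / 2`.
  set t : ℝ := a / (n * κ ^ 2 * L ^ 2) with ht
  have htpos : 0 < t := by positivity
  have htF (x y : Fin n → E d) : |t * F x - t * F y| ≤ (t * L) * ∑ i, ‖x i - y i‖ := by
    rw [← mul_sub, abs_mul, abs_of_pos htpos, mul_assoc]
    exact mul_le_mul_of_nonneg_left (hF x y) htpos.le
  have hc := continuous_of_abs_sub_le_sum hF
  have hle := lintegral_exp_pi_le (L := t * L) hT.integrable_norm
    (fun f hf => hT.lintegral_exp_le hκ (by positivity) hf) htF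
  have hi : Integrable (fun x => Real.exp (t * F x)) (Measure.pi fun _ => μ) := by
    refine ⟨by fun_prop, ?_⟩
    refine lt_of_le_of_lt (le_of_eq ?_) (hle.trans_lt ENNReal.ofReal_lt_top)
    exact lintegral_congr fun x => by rw [Real.enorm_eq_ofReal (Real.exp_pos _).le]
  rw [← ofReal_integral_eq_lintegral_ofReal hi (.of_forall fun x => (Real.exp_pos _).le),
    ENNReal.ofReal_le_ofReal_iff (Real.exp_pos _).le, integral_const_mul] at hle
  refine (measure_ge_le_exp_mul_mgf _ htpos.le hi).trans ?_
  refine (mul_le_mul_of_nonneg_left hle (Real.exp_pos _).le).trans (le_of_eq ?_)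
  rw [← Real.exp_add]
  congr 1
  rw [ht]
  field_simp
  ring

end Transport

/-! ### Second moment and deviation bounds for the empirical measure -/

section EmpiricalMeasure

variable {d : ℕ} {Φ : Set (E d → ℝ)} {A₁ A₂ A₃ : ℝ} {μ : Measure (E d)} [IsProbabilityMeasure μ]

lemma IsTestClass.memLp_gmmd_empirical (hΦ : IsTestClass Φ A₁ A₂ A₃)
    (hμ : MemLp (fun x => ‖x‖) 2 μ) {n : ℕ} (hn : 1 ≤ n) :
    MemLp (fun x : Fin n → E d => gmmd Φ μ (empirical x)) 2 (Measure.pi fun _ => μ) :=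
  memLp_pi_of_abs_sub_le_sum
    (hΦ.abs_gmmd_empirical_sub_le (hμ.integrable (by norm_num)) hn) hμ

/-- The second moment bound for the mean discrepancy of the empirical measure. -/
lemma IsTestClass.integral_sq_gmmd_empirical_le (hΦ : IsTestClass Φ A₁ A₂ A₃)
    (hμ : MemLp (fun x => ‖x‖) 2 μ) {n : ℕ} (hn : 1 ≤ n) :
    ∫ x, gmmd Φ μ (empirical x) ^ 2 ∂(Measure.pi fun _ : Fin n => μ)
      ≤ A₁ ^ 2 / n * ∫ x, ‖x‖ ^ 2 ∂μ + 4 * A₃ ^ 2 / n * ∫ x, (‖x‖ ^ 2 + 1) ∂μ := by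
  have hnpos : (0 : ℝ) < n := by exact_mod_cast hn
  have h1 := integral_sq_pi_le hμ
    (hΦ.abs_gmmd_empirical_sub_le (hμ.integrable (by norm_num)) hn)
  have h2 := hΦ.integral_gmmd_empirical_le hμ hn
  have h3 : 0 ≤ ∫ x, gmmd Φ μ (empirical x) ∂(Measure.pi fun _ : Fin n => μ) :=
    integral_nonneg fun x => gmmd_nonneg _ _
  have hM : 0 ≤ ∫ x, (‖x‖ ^ 2 + 1) ∂μ := integral_nonneg fun x => by positivity
  have h4 := pow_le_pow_left₀ h3 h2 2
  rw [mul_pow, div_pow, Real.sq_sqrt hM, Real.sq_sqrt hnpos.le] at h4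
  have h5 : (n : ℝ) * ((A₁ / n) ^ 2 * ∫ x, ‖x‖ ^ 2 ∂μ) = A₁ ^ 2 / n * ∫ x, ‖x‖ ^ 2 ∂μ := by
    field_simp
  have h6 : (2 * A₃) ^ 2 = 4 * A₃ ^ 2 := by ring
  rw [h6] at h4
  rw [h5] at h1
  linarith

/-- The deviation bound for the mean discrepancy of the empirical measure. -/
lemma IsTestClass.measureReal_gmmd_empirical_ge_le (hΦ : IsTestClass Φ A₁ A₂ A₃) {κ : ℝ}
    (hκ : 0 < κ) (hT : SatisfiesT1 κ μ) {n : ℕ} (hn : 1 ≤ n) {a : ℝ} (ha : 0 ≤ a) :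
    (Measure.pi fun _ : Fin n => μ).real {x | a ≤ gmmd Φ μ (empirical x) -
        2 * A₃ / √(n : ℝ) * √(∫ x, (‖x‖ ^ 2 + 1) ∂μ)}
      ≤ Real.exp (-(n * a ^ 2) / (2 * A₁ ^ 2 * κ ^ 2)) := by
  have hnpos : (0 : ℝ) < n := by exact_mod_cast hn
  have hA := hΦ.pos₁
  have hmean := hΦ.integral_gmmd_empirical_le (hT.memLp_norm hκ) hn
  -- Since the mean is below the centering term, the event lies in a deviation event about the mean.
  -- With `L = A₁ / n`, the denominator `2 n κ² L²` becomes `2 A₁² κ² / n`.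
  refine (measureReal_mono ?_).trans ((hT.measureReal_pi_ge_le hκ (div_pos hA hnpos) hn
    (hΦ.abs_gmmd_empirical_sub_le hT.integrable_norm hn) ha).trans (le_of_eq ?_))
  · intro x hx
    simp only [Set.mem_ofPred_eq] at hx ⊢
    linarith
  · congr 1
    field_simp

end EmpiricalMeasure

end GMMD

/-! ### Assembly, and transfer from the product measure to an arbitrary i.i.d. sample -/

theorem theorem2p1 (d : ℕ) (Φ : Set (GMMD.E d → ℝ)) (A₁ A₂ A₃ : ℝ)
    (hΦ : GMMD.IsTestClass Φ A₁ A₂ A₃) :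
    -- (a) the supremum defining `D_Φ` is finite, `D_Φ` is a metric, and the Wasserstein bounds
    ((∀ μ ∈ GMMD.finiteMoment d 1, ∀ ν ∈ GMMD.finiteMoment d 1,
        BddAbove (Set.range fun f : Φ => |(∫ x, f.1 x ∂μ) - ∫ x, f.1 x ∂ν|)) ∧
      GMMD.IsMetricOn (GMMD.finiteMoment d 1) (GMMD.gmmd Φ) ∧
      (∀ μ ∈ GMMD.finiteMoment d 1, ∀ ν ∈ GMMD.finiteMoment d 1,
        ENNReal.ofReal (GMMD.gmmd Φ μ ν) ≤ ENNReal.ofReal A₁ * GMMD.wasserstein 1 μ ν) ∧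
      (∀ μ ∈ GMMD.finiteMoment d 2, ∀ ν ∈ GMMD.finiteMoment d 2,
        ENNReal.ofReal A₁ * GMMD.wasserstein 1 μ ν ≤
          ENNReal.ofReal A₁ * GMMD.wasserstein 2 μ ν)) ∧
    -- (b) first and second moment bounds for the empirical measure of an i.i.d. sample
    (∀ μ ∈ GMMD.finiteMoment d 2, ∀ n : ℕ, 1 ≤ n →
      ∀ {Ω : Type*} [MeasurableSpace Ω] (P : Measure Ω) [IsProbabilityMeasure P]
        (X : Fin n → Ω → GMMD.E d), (∀ i, HasLaw (X i) μ P) → iIndepFun X P →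
        Integrable (fun ω => GMMD.gmmd Φ μ (GMMD.empirical fun i => X i ω)) P ∧
        ∫ ω, GMMD.gmmd Φ μ (GMMD.empirical fun i => X i ω) ∂P ≤
          2 * A₃ / √(n : ℝ) * √(∫ x, (‖x‖ ^ 2 + 1) ∂μ) ∧
        Integrable (fun ω => GMMD.gmmd Φ μ (GMMD.empirical fun i => X i ω) ^ 2) P ∧
        ∫ ω, GMMD.gmmd Φ μ (GMMD.empirical fun i => X i ω) ^ 2 ∂P ≤
          A₁ ^ 2 / n * ∫ x, ‖x‖ ^ 2 ∂μ + 4 * A₃ ^ 2 / n * ∫ x, (‖x‖ ^ 2 + 1) ∂μ) ∧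
    -- (c) sub-Gaussian deviation bound under the `T₁` inequality
    (∀ (μ : Measure (GMMD.E d)) [IsProbabilityMeasure μ] (κ : ℝ), 0 < κ →
      GMMD.SatisfiesT1 κ μ →
      μ ∈ GMMD.finiteMoment d 2 ∧
      ∀ n : ℕ, 1 ≤ n →
      ∀ {Ω : Type*} [MeasurableSpace Ω] (P : Measure Ω) [IsProbabilityMeasure P]
        (X : Fin n → Ω → GMMD.E d), (∀ i, HasLaw (X i) μ P) → iIndepFun X P →
        ∀ a : ℝ, 0 ≤ a →
          P.real {ω | a ≤ GMMD.gmmd Φ μ (GMMD.empirical fun i => X i ω) -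
              2 * A₃ / √(n : ℝ) * √(∫ x, (‖x‖ ^ 2 + 1) ∂μ)} ≤
            Real.exp (-(n * a ^ 2) / (2 * A₁ ^ 2 * κ ^ 2))) := by
  refine ⟨⟨fun μ hμ ν hν => ?_, hΦ.isMetricOn_gmmd, fun μ hμ ν hν => hΦ.gmmd_le_wasserstein hμ hν,
    fun μ _ ν _ => mul_le_mul_right (GMMD.wasserstein_one_le_two μ ν) _⟩, ?_, ?_⟩
  · have := hμ.1
    have := hν.1
    exact hΦ.bddAbove_gmmd (GMMD.integrable_norm_of_mem_finiteMoment hμ)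
      (GMMD.integrable_norm_of_mem_finiteMoment hν)
  · intro μ hμ n hn Ω _ P _ X hX hind
    have := hμ.1
    have hμ2 := GMMD.memLp_norm_of_mem_finiteMoment hμ
    -- Independence and the common law make the joint law the product measure, where the bounds were
    -- proved.
    have hlaw := hind.hasLaw_pi hX
    have hD := hΦ.memLp_gmmd_empirical hμ2 hn
    have hi := hD.integrable (by norm_num)
    have e1 := hlaw.integral_comp hD.aestronglyMeasurable
    have e2 := hlaw.integral_comp hD.integrable_sq.aestronglyMeasurable
    rw [← hlaw.map_eq] at hi hD
    refine ⟨hi.comp_aemeasurable hlaw.aemeasurable,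
      e1.trans_le (hΦ.integral_gmmd_empirical_le hμ2 hn),
      hD.integrable_sq.comp_aemeasurable hlaw.aemeasurable,
      e2.trans_le (hΦ.integral_sq_gmmd_empirical_le hμ2 hn)⟩
  · intro μ _ κ hκ hT
    refine ⟨GMMD.mem_finiteMoment_two (hT.memLp_norm hκ), ?_⟩
    intro n hn Ω _ P _ X hX hind a ha
    have hlaw := hind.hasLaw_pi hX
    have hc := GMMD.continuous_of_abs_sub_le_sum
      (hΦ.abs_gmmd_empirical_sub_le hT.integrable_norm hn)
    refine (le_of_eq ?_).trans (hΦ.measureReal_gmmd_empirical_ge_le hκ hT hn ha)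
    exact hlaw.measureReal_eq (p := fun x => a ≤ GMMD.gmmd Φ μ (GMMD.empirical x) -
      2 * A₃ / √(n : ℝ) * √(∫ x, (‖x‖ ^ 2 + 1) ∂μ))
      (measurableSet_le measurable_const (hc.measurable.sub_const _))
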